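/- Fix $\hbar>0$ and $n\ge 0$. For $f\in\mathcal S(\mathbb R^n)$ let $Wf\in\mathcal S(\mathbb R^{2n})$ be its Wigner transform, $$Wf(x,p)=\Big(\frac1{2\pi\hbar}\Big)^{n}\int_{\mathbb R^n}e^{-\frac i\hbar p\cdot y}\,f(x+\tfrac12y)\,\overline{f(x-\tfrac12y)}\,dy .$$ For $\Phi\in\mathcal S(\mathbb R^{2n})$ and $\theta\in\mathcal S'(\mathbb R^{2n})$ write $(\Phi*\theta)(z)=\langle\theta,\Phi(z-\cdot)\rangle$, and for an invertible linear map $S$ of $\mathbb R^{2n}$ let $\langle\theta\circ S,\varphi\rangle=|\det S|^{-1}\langle\theta,\varphi\circ S^{-1}\rangle$. The metaplectic group $\mathrm{Mp}(n,\mathbb R)$ is the group of unitary operators on $L^2(\mathbb R^n)$ generated by the quadratic Fourier transforms $$\widehat S_{\mathcal W,m}f(x)=\Big(\frac1{2\pi i\hbar}\Big)^{n/2}i^m\sqrt{|\det L|}\int_{\mathbb R^n}e^{\frac i\hbar \mathcal W(x,x')}f(x')\,dx',\qquad \mathcal W(x,x')=\tfrac12Px\cdot x-Lx\cdot x'+\tfrac12Qx'\cdot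 x',$$ where $\arg i=\pi/2$, $P,Q$ are real symmetric $n\times n$ matrices, $L$ is real and invertible, and the integer $m$ is even if $\det L>0$, odd if $\det L<0$. The projection $\pi^{\mathrm{Mp}}:\mathrm{Mp}(n,\mathbb R)\to\mathrm{Sp}(n,\mathbb R)$ is the homomorphism that sends $\widehat S_{\mathcal W,m}$ to the free symplectic matrix $S_{\mathcal W}$ given by $(x,p)=S_{\mathcal W}(x',p')\iff p=\partial_x\mathcal W(x,x'),\ p'=-\partial_{x'}\mathcal W(x,x')$. **Proposition.** Let $\theta\in\mathcal S'(\mathbb R^{2n})$ and let $Q$ be the element of the Cohen class with kernel $\theta$, that is, $Qf=Wf*\theta$ for all $f\in\mathcal S(\mathbb R^n)$. Let $\widehat S\in\mathrm{Mp}(n,\mathbb R)$ and $S=\pi^{\mathrm{Mp}}(\widehat S)$. Then for every $f\in\mathcal S(\mathbb R^n)$ one has $\widehat Sf\in\mathcal S(\mathbb R^n)$ and $$Q(\widehat Sf)(z)=\big(Wf*(\theta\circ S)\big)(S^{-1}z)\qquad\text{for all }z\in\mathbb R^{2n}.$$ -/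

import Mathlib

open scoped SchwartzMap

noncomputable section

namespace CohenClass

open MeasureTheory LineDeriv
open scoped ContDiff InnerProductSpace ComplexConjugate

/-! ### Configuration space and phase space -/

/-- Configuration space `ℝⁿ` with its Euclidean structure. -/
abbrev Config (n : ℕ) := EuclideanSpace ℝ (Fin n)

/-- Phase space `ℝ²ⁿ = ℝⁿ × ℝⁿ`. The coordinates of `z = (x, p)` indexed by `Sum.inl` are those
of the position `x`, the ones indexed by `Sum.inr` are those of the momentum `p`. -/
abbrev Phase (n : ℕ) := EuclideanSpace ℝ (Fin n ⊕ Fin n)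

/-- The position `x` of a phase space point `z = (x, p)`. -/
def pos {n : ℕ} : Phase n →L[ℝ] Config n :=
  (PiLp.continuousLinearEquiv 2 ℝ (fun _ : Fin n => ℝ)).symm.toContinuousLinearMap ∘L
    ContinuousLinearMap.pi fun i => EuclideanSpace.proj (Sum.inl i)

/-- The momentum `p` of a phase space point `z = (x, p)`. -/
def mom {n : ℕ} : Phase n →L[ℝ] Config n :=
  (PiLp.continuousLinearEquiv 2 ℝ (fun _ : Fin n => ℝ)).symm.toContinuousLinearMap ∘L
    ContinuousLinearMap.pi fun i => EuclideanSpace.proj (Sum.inr i)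

@[simp] theorem pos_apply {n : ℕ} (z : Phase n) (i : Fin n) : pos z i = z (Sum.inl i) := rfl

@[simp] theorem mom_apply {n : ℕ} (z : Phase n) (i : Fin n) : mom z i = z (Sum.inr i) := rfl

/-! ### The Wigner transform -/

/-- The cross-Wigner (Wigner-Moyal) transform
`W(f, g)(x, p) = (1 / 2πħ)ⁿ ∫ exp(-(i/ħ) p·y) f(x + y/2) conj(g(x - y/2)) dy`. -/
def crossWigner {n : ℕ} (ħ : ℝ) (f g : Config n → ℂ) (z : Phase n) : ℂ :=
  (1 / (2 * Real.pi * ħ) : ℂ) ^ n *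
    ∫ y : Config n, Complex.exp (-(Complex.I / ħ) * (⟪mom z, y⟫_ℝ : ℂ)) *
      f (pos z + (1 / 2 : ℝ) • y) * conj (g (pos z - (1 / 2 : ℝ) • y))

/-! The rest of this part verifies that the Wigner transform of a Schwartz function is a Schwartz
function. -/

/-- A family of functions on `ℝ^ι` that is stable under derivatives and multiplication by coordinates and
consists of bounded functions consists of Schwartz functions. -/
theorem decay_of_stable {ι : Type*} [Fintype ι] (V : Set (EuclideanSpace ℝ ι → ℂ))
    (hb : ∀ h ∈ V, ∃ C : ℝ, ∀ z, ‖h z‖ ≤ C)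
    (hd : ∀ h ∈ V, Differentiable ℝ h ∧ ∀ v, (fun z => fderiv ℝ h z v) ∈ V)
    (hm : ∀ h ∈ V, ∀ i, (fun z => ((z i : ℝ) : ℂ) * h z) ∈ V) :
    ∀ h ∈ V, ContDiff ℝ ∞ h ∧
      ∀ k m : ℕ, ∃ C : ℝ, ∀ z, ‖z‖ ^ k * ‖iteratedFDeriv ℝ m h z‖ ≤ C := by
  classical
  have hs : ∀ m : ℕ, ∀ h ∈ V, ContDiff ℝ m h := by
    intro m
    induction m with
    | zero => intro h hh; exact contDiff_zero.2 (hd h hh).1.continuous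
    | succ m ih =>
      intro h hh
      have := contDiff_succ_iff_fderiv_apply (𝕜 := ℝ) (f := h) (n := m)
      push_cast
      exact this.2 ⟨(hd h hh).1, by simp, fun v => ih _ ((hd h hh).2 v)⟩
  have h0 : ∀ k : ℕ, ∀ h ∈ V, ∃ C : ℝ, ∀ z, ‖z‖ ^ k * ‖h z‖ ≤ C := by
    intro k
    induction k with
    | zero => intro h hh; simpa using hb h hh
    | succ k ih =>
      intro h hh
      choose C hC using fun i => ih _ (hm h hh i)
      refine ⟨∑ i, C i, fun z => ?_⟩
      have hz : ‖z‖ ≤ ∑ i, ‖z i‖ := by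
        conv_lhs => rw [← (EuclideanSpace.basisFun ι ℝ).sum_repr z]
        refine (norm_sum_le _ _).trans (le_of_eq ?_)
        simp [norm_smul]
      calc ‖z‖ ^ (k + 1) * ‖h z‖ = ‖z‖ ^ k * ‖h z‖ * ‖z‖ := by ring
        _ ≤ ‖z‖ ^ k * ‖h z‖ * ∑ i, ‖z i‖ := by gcongr
        _ = ∑ i, ‖z‖ ^ k * ‖((z i : ℝ) : ℂ) * h z‖ := by
            rw [Finset.mul_sum]; refine Finset.sum_congr rfl fun i _ => ?_
            rw [norm_mul, Complex.norm_real]; ring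
        _ ≤ ∑ i, C i := Finset.sum_le_sum fun i _ => hC i z
  have hall : ∀ m : ℕ, ∀ h ∈ V, ∀ k : ℕ, ∃ C : ℝ, ∀ z, ‖z‖ ^ k * ‖iteratedFDeriv ℝ m h z‖ ≤ C := by
    intro m
    induction m with
    | zero => intro h hh k; simpa using h0 k h hh
    | succ m ih =>
      intro h hh k
      choose C hC using fun i => ih _ ((hd h hh).2 (EuclideanSpace.basisFun ι ℝ i)) k
      let L : ι → (ℂ →L[ℝ] (EuclideanSpace ℝ ι →L[ℝ] ℂ)) := fun i =>
        ContinuousLinearMap.smulRightL ℝ (EuclideanSpace ℝ ι) ℂ (EuclideanSpace.proj i)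
      have hL : fderiv ℝ h = fun z => ∑ i, L i (fderiv ℝ h z (EuclideanSpace.basisFun ι ℝ i)) := by
        funext z
        ext v
        conv_lhs => rw [← (EuclideanSpace.basisFun ι ℝ).sum_repr v]
        simp [L]
      refine ⟨∑ i, ‖L i‖ * C i, fun z => ?_⟩
      have hsm : ∀ i, ContDiff ℝ m (fun z => fderiv ℝ h z (EuclideanSpace.basisFun ι ℝ i)) :=
        fun i => hs m _ ((hd h hh).2 _)
      rw [← norm_iteratedFDeriv_fderiv, hL, iteratedFDeriv_fun_sum_apply
        (f := fun i z => L i (fderiv ℝ h z (EuclideanSpace.basisFun ι ℝ i)))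
        (fun i _ => ((L i).contDiff.comp (hsm i)).contDiffAt)]
      calc _ ≤ ‖z‖ ^ k * ∑ i, ‖L i‖ * ‖iteratedFDeriv ℝ m
              (fun z => fderiv ℝ h z (EuclideanSpace.basisFun ι ℝ i)) z‖ := by
            gcongr
            refine (norm_sum_le _ _).trans (Finset.sum_le_sum fun i _ => ?_)
            exact (L i).norm_iteratedFDeriv_comp_left (hsm i).contDiffAt le_rfl
        _ = ∑ i, ‖L i‖ * (‖z‖ ^ k * ‖iteratedFDeriv ℝ m
              (fun z => fderiv ℝ h z (EuclideanSpace.basisFun ι ℝ i)) z‖) := by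
            rw [Finset.mul_sum]; refine Finset.sum_congr rfl fun i _ => by ring
        _ ≤ _ := Finset.sum_le_sum fun i _ => by gcongr; exact hC i z
  exact fun h hh => ⟨contDiff_infty.2 fun m => hs m h hh, fun k m => hall m h hh k⟩

def wignerIntegral {n : ℕ} (c : ℂ) (f g : 𝓢(Config n, ℂ)) (z : Phase n) : ℂ :=
  ∫ y : Config n, Complex.exp (c * (⟪mom z, y⟫_ℝ : ℂ)) *
    (f (pos z + (1 / 2 : ℝ) • y) * g (pos z - (1 / 2 : ℝ) • y))

theorem schwartz_decay {E F : Type*} [NormedAddCommGroup E] [NormedSpace ℝ E] [NormedAddCommGroup F] [NormedSpace ℝ F]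
    (N : ℕ) (f : 𝓢(E, F)) : ∃ C : ℝ, 0 ≤ C ∧ ∀ x, (1 + ‖x‖) ^ N * ‖f x‖ ≤ C := by
  have key := fun x => SchwartzMap.one_add_le_sup_seminorm_apply (𝕜 := ℝ) (m := (N, 0)) le_rfl le_rfl f x
  simp only [norm_iteratedFDeriv_zero] at key
  exact ⟨_, abs_nonneg _, fun x => (key x).trans (le_abs_self _)⟩

theorem schwartz_mul_decay {n : ℕ} {F G : Type*} [NormedAddCommGroup F] [NormedSpace ℝ F] [NormedAddCommGroup G] [NormedSpace ℝ G]
    (N : ℕ) (f : 𝓢(Config n, F)) (g : 𝓢(Config n, G)) : ∃ C : ℝ, 0 ≤ C ∧ ∀ x y : Config n,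
      (1 + ‖y‖) ^ N * (‖f (x + (1 / 2 : ℝ) • y)‖ * ‖g (x - (1 / 2 : ℝ) • y)‖) ≤ C := by
  obtain ⟨C, hC, hf⟩ := schwartz_decay N f
  obtain ⟨D, hD, hg⟩ := schwartz_decay N g
  refine ⟨C * D, by positivity, fun x y => ?_⟩
  set u := x + (1 / 2 : ℝ) • y
  set v := x - (1 / 2 : ℝ) • y
  have h : 1 + ‖y‖ ≤ (1 + ‖u‖) * (1 + ‖v‖) := by
    have : y = u - v := by simp only [u, v]; module
    have h2 : ‖y‖ ≤ ‖u‖ + ‖v‖ := by rw [this]; exact norm_sub_le _ _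
    nlinarith [norm_nonneg u, norm_nonneg v, mul_nonneg (norm_nonneg u) (norm_nonneg v)]
  calc _ ≤ ((1 + ‖u‖) * (1 + ‖v‖)) ^ N * (‖f u‖ * ‖g v‖) := by gcongr
    _ = ((1 + ‖u‖) ^ N * ‖f u‖) * ((1 + ‖v‖) ^ N * ‖g v‖) := by rw [mul_pow]; ring
    _ ≤ _ := by gcongr; exacts [hf u, hg v]

/-- integrable majorant -/
def majorant (n : ℕ) (y : Config n) : ℝ := (1 + ‖y‖) ^ (-((n + 1 : ℕ) : ℝ))

theorem majorant_integrable (n : ℕ) : Integrable (majorant n) := by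
  apply integrable_one_add_norm; simp

theorem le_majorant {n : ℕ} {a C : ℝ} {y : Config n} (h : (1 + ‖y‖) ^ (n + 1) * a ≤ C) : a ≤ C * majorant n y := by
  unfold majorant
  rw [Real.rpow_neg (by positivity), Real.rpow_natCast, ← div_eq_mul_inv, le_div_iff₀ (by positivity)]
  linarith

theorem norm_exp_phase {c : ℂ} (hc : c.re = 0) (t : ℝ) : ‖Complex.exp (c * (t : ℂ))‖ = 1 := by
  rw [Complex.norm_exp]; simp [hc]

theorem wignerIntegrand_integrable {n : ℕ} {c : ℂ} (hc : c.re = 0) (f g : 𝓢(Config n, ℂ)) (z : Phase n) :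
    Integrable fun y : Config n => Complex.exp (c * (⟪mom z, y⟫_ℝ : ℂ)) *
      (f (pos z + (1 / 2 : ℝ) • y) * g (pos z - (1 / 2 : ℝ) • y)) := by
  obtain ⟨C, hC, h⟩ := schwartz_mul_decay (n + 1) f g
  refine ((majorant_integrable n).const_mul C).mono' (Continuous.aestronglyMeasurable (by fun_prop)) ?_
  refine Filter.Eventually.of_forall fun y => ?_
  rw [norm_mul, norm_exp_phase hc, one_mul, norm_mul]
  exact le_majorant (h _ _)

theorem wignerIntegral_bound {n : ℕ} {c : ℂ} (hc : c.re = 0) (f g : 𝓢(Config n, ℂ)) :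
    ∃ C : ℝ, ∀ z : Phase n, ‖wignerIntegral c f g z‖ ≤ C := by
  obtain ⟨C, hC, h⟩ := schwartz_mul_decay (n + 1) f g
  refine ⟨∫ y, C * majorant n y, fun z => ?_⟩
  refine norm_integral_le_of_norm_le ((majorant_integrable n).const_mul C) (Filter.Eventually.of_forall fun y => ?_)
  rw [norm_mul, norm_exp_phase hc, one_mul, norm_mul]
  exact le_majorant (h _ _)

/-- multiplication of a Schwartz function by a linear coordinate -/
def mulLinear {n : ℕ} (b : Config n) (f : 𝓢(Config n, ℂ)) : 𝓢(Config n, ℂ) :=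
  SchwartzMap.smulLeftCLM ℂ (fun x => ((⟪b, x⟫_ℝ : ℝ) : ℂ)) f

theorem mulLinear_apply {n : ℕ} (b : Config n) (f : 𝓢(Config n, ℂ)) (x : Config n) :
    mulLinear b f x = (⟪b, x⟫_ℝ : ℂ) * f x := by
  unfold mulLinear
  rw [SchwartzMap.smulLeftCLM_apply_apply]
  · rfl
  · exact (Complex.ofRealCLM ∘L innerSL ℝ b).hasTemperateGrowth

theorem pos_mul_wignerIntegral {n : ℕ} {c : ℂ} (hc : c.re = 0) (f g : 𝓢(Config n, ℂ)) (a : Config n) (z : Phase n) :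
    (⟪a, pos z⟫_ℝ : ℂ) * wignerIntegral c f g z = (1 / 2 : ℂ) * wignerIntegral c (mulLinear a f) g z + (1 / 2 : ℂ) * wignerIntegral c f (mulLinear a g) z := by
  unfold wignerIntegral
  rw [← integral_const_mul, ← integral_const_mul, ← integral_const_mul, ← integral_add
    ((wignerIntegrand_integrable hc _ _ z).const_mul _) ((wignerIntegrand_integrable hc _ _ z).const_mul _)]
  congr 1; funext y
  simp only [mulLinear_apply, inner_add_right, inner_sub_right, inner_smul_right]
  push_cast; ring


theorem mom_mul_wignerIntegral {n : ℕ} {c : ℂ} (hc : c.re = 0) (f g : 𝓢(Config n, ℂ)) (b : Config n) (z : Phase n) :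
    c * (⟪b, mom z⟫_ℝ : ℂ) * wignerIntegral c f g z =
      (-1 / 2 : ℂ) * wignerIntegral c (∂_{b} f) g z + (1 / 2 : ℂ) * wignerIntegral c f (∂_{b} g) z := by
  have e1 : ∀ y : Config n, HasFDerivAt (fun y : Config n => Complex.exp (c * (⟪mom z, y⟫_ℝ : ℂ)))
      (Complex.exp (c * (⟪mom z, y⟫_ℝ : ℂ)) • (c • (Complex.ofRealCLM ∘L innerSL ℝ (mom z)))) y := fun y =>
    (((Complex.ofRealCLM ∘L innerSL ℝ (mom z)).hasFDerivAt (x := y)).const_mul c).cexp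
  have e2 : ∀ y : Config n, HasFDerivAt (fun y : Config n => f (pos z + (1 / 2 : ℝ) • y))
      ((fderiv ℝ f (pos z + (1 / 2 : ℝ) • y)) ∘L ((1 / 2 : ℝ) • ContinuousLinearMap.id ℝ _)) y := fun y =>
    (f.hasFDerivAt _).comp y (((hasFDerivAt_id y).const_smul (1 / 2 : ℝ)).const_add (pos z))
  have e3 : ∀ y : Config n, HasFDerivAt (fun y : Config n => g (pos z - (1 / 2 : ℝ) • y))
      ((fderiv ℝ g (pos z - (1 / 2 : ℝ) • y)) ∘L (-((1 / 2 : ℝ) • ContinuousLinearMap.id ℝ _))) y := fun y =>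
    (g.hasFDerivAt _).comp y (((hasFDerivAt_id y).const_smul (1 / 2 : ℝ)).const_sub (pos z))
  have e4 := fun y => (e2 y).fun_mul (e3 y)
  have d1 : ∀ y, fderiv ℝ (fun y : Config n => Complex.exp (c * (⟪mom z, y⟫_ℝ : ℂ))) y b =
      c * (⟪b, mom z⟫_ℝ : ℂ) * Complex.exp (c * (⟪mom z, y⟫_ℝ : ℂ)) := fun y => by
    rw [(e1 y).fderiv]; simp [real_inner_comm]; ring
  have d2 : ∀ y, fderiv ℝ (fun y : Config n => f (pos z + (1 / 2 : ℝ) • y) * g (pos z - (1 / 2 : ℝ) • y)) y b =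
      (1 / 2 : ℂ) * ((∂_{b} f) (pos z + (1 / 2 : ℝ) • y) * g (pos z - (1 / 2 : ℝ) • y)) +
      (-1 / 2 : ℂ) * (f (pos z + (1 / 2 : ℝ) • y) * (∂_{b} g) (pos z - (1 / 2 : ℝ) • y)) := fun y => by
    rw [HasFDerivAt.fderiv (e4 y)]
    simp [SchwartzMap.lineDerivOp_apply_eq_fderiv]; ring
  have i1 := wignerIntegrand_integrable hc f g z
  have i2 := wignerIntegrand_integrable hc (∂_{b} f) g z
  have i3 := wignerIntegrand_integrable hc f (∂_{b} g) z
  have key := integral_mul_fderiv_eq_neg_fderiv_mul_of_integrable (μ := volume) (𝕜 := ℂ) (v := b)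
    (f := fun y : Config n => Complex.exp (c * (⟪mom z, y⟫_ℝ : ℂ)))
    (g := fun y : Config n => f (pos z + (1 / 2 : ℝ) • y) * g (pos z - (1 / 2 : ℝ) • y))
    (by simp_rw [d1, mul_assoc]; exact (i1.const_mul _).const_mul _)
    (by simp_rw [d2]; refine ((i2.const_mul (1/2)).add (i3.const_mul (-1/2))).congr
          (Filter.Eventually.of_forall fun y => ?_)
        simp only [Pi.add_apply]; ring)
    i1 (fun y _ => (e1 y).differentiableAt) (fun y _ => (e4 y).differentiableAt)
  simp_rw [d1, d2, mul_assoc, integral_const_mul] at key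
  rw [← neg_eq_iff_eq_neg] at key
  unfold wignerIntegral
  rw [mul_assoc, ← key, ← integral_const_mul (-1 / 2 : ℂ), ← integral_const_mul (1 / 2 : ℂ), ← integral_add
    (i2.const_mul _) (i3.const_mul _), ← integral_neg]
  congr 1; funext y; ring

theorem wignerIntegral_fderiv {n : ℕ} {c : ℂ} (hc : c.re = 0) (f g : 𝓢(Config n, ℂ)) (z : Phase n) :
    DifferentiableAt ℝ (wignerIntegral c f g) z ∧ ∀ v, fderiv ℝ (wignerIntegral c f g) z v =
      wignerIntegral c (∂_{pos v} f) g z + wignerIntegral c f (∂_{pos v} g) z +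
        (c * wignerIntegral c (mulLinear (mom v) f) g z - c * wignerIntegral c f (mulLinear (mom v) g) z) := by
  let f' := SchwartzMap.fderivCLM ℝ (Config n) ℂ f
  let g' := SchwartzMap.fderivCLM ℝ (Config n) ℂ g
  let E : Phase n → Config n → ℂ := fun z y => Complex.exp (c * (⟪mom z, y⟫_ℝ : ℂ))
  let F' : Phase n → Config n → Phase n →L[ℝ] ℂ := fun z y =>
    E z y • (f (pos z + (1 / 2 : ℝ) • y) • (g' (pos z - (1 / 2 : ℝ) • y) ∘L pos) +
      g (pos z - (1 / 2 : ℝ) • y) • (f' (pos z + (1 / 2 : ℝ) • y) ∘L pos)) +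
    (f (pos z + (1 / 2 : ℝ) • y) * g (pos z - (1 / 2 : ℝ) • y)) •
      (E z y • (c • (Complex.ofRealCLM ∘L (innerSL ℝ y ∘L mom))))
  obtain ⟨C1, hC1, h1⟩ := schwartz_mul_decay (n + 1) f g'
  obtain ⟨C2, hC2, h2⟩ := schwartz_mul_decay (n + 1) f' g
  obtain ⟨C3, hC3, h3⟩ := schwartz_mul_decay (n + 1 + 1) f g
  let P : ℝ := ‖(pos : Phase n →L[ℝ] Config n)‖
  let M : ℝ := ‖(mom : Phase n →L[ℝ] Config n)‖
  have hbd : ∀ z y, ‖F' z y‖ ≤ (C1 * P + C2 * P + C3 * ‖c‖ * M) * majorant n y := fun z y => by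
    have k1 := le_majorant (h1 (pos z) y)
    have k2 := le_majorant (h2 (pos z) y)
    have k3 : ‖f (pos z + (1 / 2 : ℝ) • y)‖ * ‖g (pos z - (1 / 2 : ℝ) • y)‖ * ‖y‖ ≤ C3 * majorant n y := by
      apply le_majorant
      refine le_trans ?_ (h3 (pos z) y)
      rw [pow_succ (1 + ‖y‖) (n + 1)]
      have : ‖y‖ ≤ 1 + ‖y‖ := by linarith
      calc _ = (1 + ‖y‖) ^ (n + 1) * ‖y‖ * (‖f (pos z + (1 / 2 : ℝ) • y)‖ * ‖g (pos z - (1 / 2 : ℝ) • y)‖) := by ring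
        _ ≤ _ := by gcongr
    have hE : ‖E z y‖ = 1 := norm_exp_phase hc _
    have n1 : ‖g' (pos z - (1 / 2 : ℝ) • y) ∘L (pos : Phase n →L[ℝ] Config n)‖ ≤ ‖g' (pos z - (1 / 2 : ℝ) • y)‖ * P :=
      ContinuousLinearMap.opNorm_comp_le _ _
    have n2 : ‖f' (pos z + (1 / 2 : ℝ) • y) ∘L (pos : Phase n →L[ℝ] Config n)‖ ≤ ‖f' (pos z + (1 / 2 : ℝ) • y)‖ * P :=
      ContinuousLinearMap.opNorm_comp_le _ _
    have n3 : ‖Complex.ofRealCLM ∘L (innerSL ℝ y ∘L (mom : Phase n →L[ℝ] Config n))‖ ≤ ‖y‖ * M := by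
      refine (ContinuousLinearMap.opNorm_comp_le _ _).trans ?_
      rw [Complex.ofRealCLM_norm, one_mul]
      refine (ContinuousLinearMap.opNorm_comp_le _ _).trans ?_
      rw [innerSL_apply_norm]
    calc ‖F' z y‖ ≤ (‖f (pos z + (1 / 2 : ℝ) • y)‖ * (‖g' (pos z - (1 / 2 : ℝ) • y)‖ * P) +
            ‖g (pos z - (1 / 2 : ℝ) • y)‖ * (‖f' (pos z + (1 / 2 : ℝ) • y)‖ * P)) +
          (‖f (pos z + (1 / 2 : ℝ) • y)‖ * ‖g (pos z - (1 / 2 : ℝ) • y)‖) * (‖c‖ * (‖y‖ * M)) := by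
            refine (norm_add_le _ _).trans (add_le_add ?_ ?_)
            · rw [norm_smul, hE, one_mul]
              refine (norm_add_le _ _).trans (add_le_add ?_ ?_)
              · rw [norm_smul]; gcongr
              · rw [norm_smul]; gcongr
            · rw [norm_smul, norm_smul, norm_smul, hE, one_mul, norm_mul]; gcongr
      _ = (‖f (pos z + (1 / 2 : ℝ) • y)‖ * ‖g' (pos z - (1 / 2 : ℝ) • y)‖) * P +
          (‖f' (pos z + (1 / 2 : ℝ) • y)‖ * ‖g (pos z - (1 / 2 : ℝ) • y)‖) * P +
          (‖f (pos z + (1 / 2 : ℝ) • y)‖ * ‖g (pos z - (1 / 2 : ℝ) • y)‖ * ‖y‖) * (‖c‖ * M) := by ring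
      _ ≤ (C1 * majorant n y) * P + (C2 * majorant n y) * P + (C3 * majorant n y) * (‖c‖ * M) := by gcongr
      _ = _ := by ring
  have hder : ∀ z y, HasFDerivAt (fun z : Phase n => Complex.exp (c * (⟪mom z, y⟫_ℝ : ℂ)) *
      (f (pos z + (1 / 2 : ℝ) • y) * g (pos z - (1 / 2 : ℝ) • y))) (F' z y) z := fun z y => by
    have e1 : HasFDerivAt (fun z : Phase n => Complex.exp (c * (⟪mom z, y⟫_ℝ : ℂ)))
        (E z y • (c • (Complex.ofRealCLM ∘L (innerSL ℝ y ∘L mom)))) z := by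
      have := (((Complex.ofRealCLM ∘L (innerSL ℝ y ∘L (mom : Phase n →L[ℝ] Config n))).hasFDerivAt
        (x := z)).const_mul c).cexp
      simpa [E, real_inner_comm] using this
    have e2 : HasFDerivAt (fun z : Phase n => f (pos z + (1 / 2 : ℝ) • y))
        (f' (pos z + (1 / 2 : ℝ) • y) ∘L pos) z :=
      (f.hasFDerivAt _).comp z (((pos : Phase n →L[ℝ] Config n).hasFDerivAt (x := z)).add_const _)
    have e3 : HasFDerivAt (fun z : Phase n => g (pos z - (1 / 2 : ℝ) • y))
        (g' (pos z - (1 / 2 : ℝ) • y) ∘L pos) z :=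
      (g.hasFDerivAt _).comp z (((pos : Phase n →L[ℝ] Config n).hasFDerivAt (x := z)).sub_const _)
    exact e1.mul (e2.mul e3)
  have hmeas : AEStronglyMeasurable (F' z) volume := by
    apply Continuous.aestronglyMeasurable
    have : Continuous fun y : Config n => innerSL ℝ y := (innerSL ℝ (E := Config n)).continuous
    simp only [F', E]
    fun_prop
  have hb := (majorant_integrable n).const_mul (C1 * P + C2 * P + C3 * ‖c‖ * M)
  have main := hasFDerivAt_integral_of_dominated_of_fderiv_le (𝕜 := ℝ) (μ := volume) (x₀ := z)
    (F := fun (z : Phase n) (y : Config n) => Complex.exp (c * (⟪mom z, y⟫_ℝ : ℂ)) *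
      (f (pos z + (1 / 2 : ℝ) • y) * g (pos z - (1 / 2 : ℝ) • y))) (F' := F') Filter.univ_mem
    (Filter.Eventually.of_forall fun z => (wignerIntegrand_integrable hc f g z).1) (wignerIntegrand_integrable hc f g z) hmeas
    (Filter.Eventually.of_forall fun y z _ => hbd z y) hb (Filter.Eventually.of_forall fun y z _ => hder z y)
  refine ⟨main.differentiableAt, fun v => ?_⟩
  have hF' : Integrable (F' z) := hb.mono' hmeas (Filter.Eventually.of_forall fun y => hbd z y)
  have : fderiv ℝ (wignerIntegral c f g) z = ∫ y, F' z y := main.fderiv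
  rw [this, ContinuousLinearMap.integral_apply hF']
  unfold wignerIntegral
  have i1 := wignerIntegrand_integrable hc (∂_{pos v} f) g z
  have i2 := wignerIntegrand_integrable hc f (∂_{pos v} g) z
  have i3 := wignerIntegrand_integrable hc (mulLinear (mom v) f) g z
  have i4 := wignerIntegrand_integrable hc f (mulLinear (mom v) g) z
  rw [← integral_const_mul, ← integral_const_mul, ← integral_sub (i3.const_mul c) (i4.const_mul c),
    ← integral_add i1 i2, ← integral_add (by exact i1.add i2)
    (by exact (i3.const_mul c).sub (i4.const_mul c))]
  congr 1; funext y
  simp only [mulLinear_apply, inner_add_right, inner_sub_right, inner_smul_right]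
  simp [F', E, f', g', SchwartzMap.lineDerivOp_apply_eq_fderiv, real_inner_comm]
  ring


def conjSchwartz {n : ℕ} (f : 𝓢(Config n, ℂ)) : 𝓢(Config n, ℂ) :=
  SchwartzMap.postcompCLM (𝕜 := ℝ) Complex.conjCLE.toContinuousLinearMap f

theorem conjSchwartz_apply {n : ℕ} (f : 𝓢(Config n, ℂ)) (x : Config n) :
    conjSchwartz f x = (starRingEnd ℂ) (f x) := rfl

theorem wignerIntegral_decay {n : ℕ} {c : ℂ} (hc : c.re = 0) (hc0 : c ≠ 0) (f g : 𝓢(Config n, ℂ)) :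
    ContDiff ℝ ∞ (wignerIntegral c f g) ∧
      ∀ k m : ℕ, ∃ C : ℝ, ∀ z, ‖z‖ ^ k * ‖iteratedFDeriv ℝ m (wignerIntegral c f g) z‖ ≤ C := by
  let V : Submodule ℂ (Phase n → ℂ) :=
    Submodule.span ℂ (Set.range fun q : 𝓢(Config n, ℂ) × 𝓢(Config n, ℂ) => wignerIntegral c q.1 q.2)
  have hV : ∀ f g, wignerIntegral c f g ∈ V := fun f g => Submodule.subset_span ⟨(f, g), rfl⟩
  refine decay_of_stable (V : Set (Phase n → ℂ)) ?_ ?_ ?_ _ (hV f g)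
  · intro h hh
    induction hh using Submodule.span_induction with
    | mem x hx => obtain ⟨q, rfl⟩ := hx; exact wignerIntegral_bound hc _ _
    | zero => exact ⟨0, by simp⟩
    | add x y _ _ hx hy =>
      obtain ⟨C, hC⟩ := hx
      obtain ⟨D, hD⟩ := hy
      exact ⟨C + D, fun z => (norm_add_le _ _).trans (add_le_add (hC z) (hD z))⟩
    | smul a x _ hx =>
      obtain ⟨C, hC⟩ := hx
      refine ⟨‖a‖ * C, fun z => ?_⟩
      rw [Pi.smul_apply, norm_smul]
      gcongr
      exact hC z
  · intro h hh
    induction hh using Submodule.span_induction with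
    | mem x hx =>
      obtain ⟨q, rfl⟩ := hx
      refine ⟨fun z => (wignerIntegral_fderiv hc q.1 q.2 z).1, fun v => ?_⟩
      have : (fun z => fderiv ℝ (wignerIntegral c q.1 q.2) z v) =
          wignerIntegral c (∂_{pos v} q.1) q.2 + wignerIntegral c q.1 (∂_{pos v} q.2) +
            (c • wignerIntegral c (mulLinear (mom v) q.1) q.2 - c • wignerIntegral c q.1 (mulLinear (mom v) q.2)) := by
        funext z
        rw [(wignerIntegral_fderiv hc q.1 q.2 z).2 v]
        rfl
      exact this ▸ V.add_mem (V.add_mem (hV _ _) (hV _ _))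
        (V.sub_mem (V.smul_mem _ (hV _ _)) (V.smul_mem _ (hV _ _)))
    | zero =>
      refine ⟨differentiable_const 0, fun v => ?_⟩
      have : (fun z => fderiv ℝ (0 : Phase n → ℂ) z v) = 0 := by funext z; simp
      rw [this]; exact V.zero_mem
    | add x y _ _ hx hy =>
      refine ⟨hx.1.add hy.1, fun v => ?_⟩
      have : (fun z => fderiv ℝ (x + y) z v) =
          (fun z => fderiv ℝ x z v) + fun z => fderiv ℝ y z v := by
        funext z; rw [fderiv_add (hx.1 z) (hy.1 z)]; rfl
      exact this ▸ V.add_mem (hx.2 v) (hy.2 v)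
    | smul a x _ hx =>
      refine ⟨hx.1.const_smul a, fun v => ?_⟩
      have : (fun z => fderiv ℝ (a • x) z v) = a • fun z => fderiv ℝ x z v := by
        funext z; rw [fderiv_const_smul (hx.1 z)]; rfl
      exact this ▸ V.smul_mem a (hx.2 v)
  · intro h hh i
    induction hh using Submodule.span_induction with
    | mem x hx =>
      obtain ⟨q, rfl⟩ := hx
      rcases i with i | i
      · have : (fun z : Phase n => ((z (Sum.inl i) : ℝ) : ℂ) * wignerIntegral c q.1 q.2 z) =
            (1 / 2 : ℂ) • wignerIntegral c (mulLinear (EuclideanSpace.single i 1) q.1) q.2 +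
              (1 / 2 : ℂ) • wignerIntegral c q.1 (mulLinear (EuclideanSpace.single i 1) q.2) := by
          funext z
          have := pos_mul_wignerIntegral hc q.1 q.2 (EuclideanSpace.single i 1) z
          simpa [EuclideanSpace.inner_single_left] using this
        exact this ▸ V.add_mem (V.smul_mem _ (hV _ _)) (V.smul_mem _ (hV _ _))
      · have : (fun z : Phase n => ((z (Sum.inr i) : ℝ) : ℂ) * wignerIntegral c q.1 q.2 z) =
            c⁻¹ • ((-1 / 2 : ℂ) • wignerIntegral c (∂_{EuclideanSpace.single i (1 : ℝ)} q.1) q.2 +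
              (1 / 2 : ℂ) • wignerIntegral c q.1 (∂_{EuclideanSpace.single i (1 : ℝ)} q.2)) := by
          funext z
          have := mom_mul_wignerIntegral hc q.1 q.2 (EuclideanSpace.single i 1) z
          simp only [EuclideanSpace.inner_single_left, map_one, one_mul, mom_apply] at this
          simp only [Pi.smul_apply, Pi.add_apply, smul_eq_mul]
          rw [← this]
          field_simp
        exact this ▸ V.smul_mem _ (V.add_mem (V.smul_mem _ (hV _ _)) (V.smul_mem _ (hV _ _)))
    | zero =>
      have : (fun z : Phase n => ((z i : ℝ) : ℂ) * (0 : Phase n → ℂ) z) = 0 := by funext z; simp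
      rw [this]; exact V.zero_mem
    | add x y _ _ hx hy =>
      have : (fun z : Phase n => ((z i : ℝ) : ℂ) * (x + y) z) =
          (fun z : Phase n => ((z i : ℝ) : ℂ) * x z) + fun z : Phase n => ((z i : ℝ) : ℂ) * y z := by
        funext z; simp [mul_add]
      exact this ▸ V.add_mem hx hy
    | smul a x _ hx =>
      have : (fun z : Phase n => ((z i : ℝ) : ℂ) * (a • x) z) =
          a • fun z : Phase n => ((z i : ℝ) : ℂ) * x z := by
        funext z; simp; ring
      exact this ▸ V.smul_mem a hx

theorem phase_re (ħ : ℝ) : (-(Complex.I / ħ) : ℂ).re = 0 := by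
  simp [Complex.div_re]

theorem phase_ne {ħ : ℝ} (hħ : 0 < ħ) : (-(Complex.I / ħ) : ℂ) ≠ 0 := by
  simp [hħ.ne']

theorem crossWigner_eq {n : ℕ} (ħ : ℝ) (f : 𝓢(Config n, ℂ)) :
    crossWigner (n := n) ħ f f = fun z => (1 / (2 * Real.pi * ħ) : ℂ) ^ n *
      wignerIntegral (-(Complex.I / ħ)) f (conjSchwartz f) z := by
  funext z
  simp only [crossWigner, wignerIntegral, conjSchwartz_apply, mul_assoc]

/-- The Wigner transform `Wf = W(f, f)` of a Schwartz function `f`, as a Schwartz function. -/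
def wigner {n : ℕ} {ħ : ℝ} (hħ : 0 < ħ) (f : 𝓢(Config n, ℂ)) : 𝓢(Phase n, ℂ) where
  toFun := crossWigner ħ f f
  smooth' := by
    rw [crossWigner_eq]
    exact contDiff_const.mul (wignerIntegral_decay (phase_re ħ) (phase_ne hħ) f (conjSchwartz f)).1
  decay' k m := by
    obtain ⟨hs, hd⟩ := wignerIntegral_decay (phase_re ħ) (phase_ne hħ) f (conjSchwartz f)
    obtain ⟨C, hC⟩ := hd k m
    refine ⟨‖(1 / (2 * Real.pi * ħ) : ℂ) ^ n‖ * C, fun z => ?_⟩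
    rw [crossWigner_eq]
    have hz := iteratedFDeriv_const_smul_apply (𝕜 := ℝ) (i := m) (x := z)
      (a := (1 / (2 * Real.pi * ħ) : ℂ) ^ n) (f := wignerIntegral (-(Complex.I / ħ)) f (conjSchwartz f))
      (hs.of_le (mod_cast le_top)).contDiffAt
    change ‖z‖ ^ k * ‖iteratedFDeriv ℝ m (((1 / (2 * Real.pi * ħ) : ℂ) ^ n) •
      wignerIntegral (-(Complex.I / ħ)) f (conjSchwartz f)) z‖ ≤ _
    rw [hz, norm_smul]
    calc _ = ‖(1 / (2 * Real.pi * ħ) : ℂ) ^ n‖ * (‖z‖ ^ k *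
          ‖iteratedFDeriv ℝ m (wignerIntegral (-(Complex.I / ħ)) f (conjSchwartz f)) z‖) := by ring
      _ ≤ _ := by gcongr; exact hC z

@[simp] theorem wigner_apply {n : ℕ} {ħ : ℝ} (hħ : 0 < ħ) (f : 𝓢(Config n, ℂ)) (z : Phase n) :
    wigner hħ f z = crossWigner ħ f f z := rfl

/-! ### Convolution and composition for tempered distributions -/

/-- The convolution `(Φ ∗ θ)(z) = ⟨θ, Φ(z - ·)⟩` of a Schwartz function `Φ` with a tempered
distribution `θ`; it is a (smooth) function. -/
def conv {n : ℕ} (Φ : 𝓢(Phase n, ℂ)) (θ : 𝓢'(Phase n, ℂ)) (z : Phase n) : ℂ :=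
  θ (SchwartzMap.compSubConstCLM ℂ z
    (SchwartzMap.compCLMOfContinuousLinearEquiv ℂ (ContinuousLinearEquiv.neg ℝ) Φ))

/-- The test function used in `conv` is `w ↦ Φ(z - w)`. -/
theorem conv_test_apply {n : ℕ} (Φ : 𝓢(Phase n, ℂ)) (z w : Phase n) :
    SchwartzMap.compSubConstCLM ℂ z
      (SchwartzMap.compCLMOfContinuousLinearEquiv ℂ (ContinuousLinearEquiv.neg ℝ) Φ) w
        = Φ (z - w) := by
  simp

/-- The composition `θ ∘ A` of a tempered distribution with an invertible linear map `A`: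
`⟨θ ∘ A, φ⟩ = |det A|⁻¹ ⟨θ, φ ∘ A⁻¹⟩`. -/
def compEquiv {n : ℕ} (θ : 𝓢'(Phase n, ℂ)) (A : Phase n ≃L[ℝ] Phase n) : 𝓢'(Phase n, ℂ) :=
  ((|LinearMap.det (A : Phase n →ₗ[ℝ] Phase n)|⁻¹ : ℝ) : ℂ) •
    PointwiseConvergenceCLM.precomp ℂ
      (SchwartzMap.compCLMOfContinuousLinearEquiv ℂ A.symm : 𝓢(Phase n, ℂ) →L[ℂ] 𝓢(Phase n, ℂ)) θ

/-- `Q` is the element of the Cohen class with kernel `θ`: `Qf = Wf ∗ θ` for all Schwartz `f`. -/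
def IsCohenWithKernel {n : ℕ} {ħ : ℝ} (hħ : 0 < ħ) (θ : 𝓢'(Phase n, ℂ))
    (Q : 𝓢(Config n, ℂ) → Phase n → ℂ) : Prop :=
  ∀ f : 𝓢(Config n, ℂ), Q f = conv (wigner hħ f) θ

/-! ### The metaplectic group -/

/-- The real symplectic group `Sp(n, ℝ)` of `2n × 2n` matrices. -/
abbrev Sp (n : ℕ) := Matrix.symplecticGroup (Fin n) ℝ

/-- The invertible linear map `z ↦ S z` of phase space given by a symplectic matrix `S`. -/
def Sp.toEquiv {n : ℕ} (S : Sp n) : Phase n ≃L[ℝ] Phase n :=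
  ContinuousLinearEquiv.equivOfInverse
    (Matrix.toEuclideanCLM (𝕜 := ℝ) (S : Matrix (Fin n ⊕ Fin n) (Fin n ⊕ Fin n) ℝ))
    (Matrix.toEuclideanCLM (𝕜 := ℝ) ((S⁻¹ : Sp n) : Matrix (Fin n ⊕ Fin n) (Fin n ⊕ Fin n) ℝ))
    (fun z => by
      rw [← mul_apply_eq_comp, ← map_mul, ← Submonoid.coe_mul, inv_mul_cancel]; simp)
    (fun z => by
      rw [← mul_apply_eq_comp, ← map_mul, ← Submonoid.coe_mul, mul_inv_cancel]; simp)

/-- A non-degenerate quadratic generating function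
`W(x, x') = ½ Px·x - Lx·x' + ½ Qx'·x'` with `P`, `Q` symmetric and `L` invertible. -/
structure GeneratingFunction (n : ℕ) where
  /-- the quadratic part in `x` -/
  P : Matrix (Fin n) (Fin n) ℝ
  /-- the mixed part -/
  L : Matrix (Fin n) (Fin n) ℝ
  /-- the quadratic part in the second variable -/
  Q : Matrix (Fin n) (Fin n) ℝ
  P_symm : P.IsSymm
  Q_symm : Q.IsSymm
  L_det : L.det ≠ 0

open scoped Matrix in
/-- The value `W(x, x')`. -/
def GeneratingFunction.val {n : ℕ} (W : GeneratingFunction n) (x y : Config n) : ℝ :=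
  1 / 2 * ((W.P *ᵥ x.ofLp) ⬝ᵥ x.ofLp) - (W.L *ᵥ x.ofLp) ⬝ᵥ y.ofLp
    + 1 / 2 * ((W.Q *ᵥ y.ofLp) ⬝ᵥ y.ofLp)

open scoped Matrix in
/-- `S` is the free symplectic matrix `S_W` generated by `W`: one has `(x, p) = S (x', p')` for
`p = ∂W/∂x = Px - Lᵀx'` and `p' = -∂W/∂x' = Lx - Qx'`. (As `L` is invertible, this determines
`S`.) -/
def GeneratingFunction.Generates {n : ℕ} (W : GeneratingFunction n) (S : Sp n) : Prop :=
  ∀ x y : Fin n → ℝ,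
    (S : Matrix (Fin n ⊕ Fin n) (Fin n ⊕ Fin n) ℝ) *ᵥ Sum.elim y (W.L *ᵥ x - W.Q *ᵥ y)
      = Sum.elim x (W.P *ᵥ x - W.Lᵀ *ᵥ y)

/-- The integer `m` is a Maslov index of `W`: `m π` is an argument of `det L`, that is,
`m` is even if `det L > 0` and odd if `det L < 0`. -/
def GeneratingFunction.IsMaslovIndex {n : ℕ} (W : GeneratingFunction n) (m : ℤ) : Prop :=
  0 < (-1 : ℝ) ^ m * W.L.det

/-- The quadratic Fourier transform
`Ŝ_{W,m} f(x) = (1 / 2πiħ)^{n/2} i^m |det L|^{1/2} ∫ exp((i/ħ) W(x, x')) f(x') dx'`,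
with the principal branch of the power, that is, `arg i = π/2`. -/
def quadraticFourier {n : ℕ} (ħ : ℝ) (W : GeneratingFunction n) (m : ℤ) (f : Config n → ℂ)
    (x : Config n) : ℂ :=
  (1 / (2 * Real.pi * Complex.I * ħ) : ℂ) ^ ((n : ℂ) / 2) * Complex.I ^ m
    * (Real.sqrt |W.L.det| : ℂ)
    * ∫ y : Config n, Complex.exp (Complex.I / ħ * (W.val x y : ℂ)) * f y

/-- The Hilbert space `L²(ℝⁿ)`. -/
abbrev L2 (n : ℕ) := Lp ℂ 2 (volume : Measure (Config n))

/-- The unitary operator `U` on `L²(ℝⁿ)` is the (unique) continuous extension to `L²(ℝⁿ)` of the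
quadratic Fourier transform `Ŝ_{W,m}` on the Schwartz space. -/
def IsQuadraticFourier {n : ℕ} (ħ : ℝ) (W : GeneratingFunction n) (m : ℤ)
    (U : L2 n ≃ₗᵢ[ℂ] L2 n) : Prop :=
  ∀ f : 𝓢(Config n, ℂ), (U (f.toLp 2) : Config n → ℂ) =ᵐ[volume] quadraticFourier ħ W m f

/-- The metaplectic group `Mp(n, ℝ)`, as a covering group of `Sp(n, ℝ)` realised by unitary
operators: the group generated by the quadratic Fourier transforms `Ŝ_{W,m}`, each of them taken
together with the free symplectic matrix `S_W` that it covers. Thus an element is a metaplectic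
operator `Ŝ` together with its projection `S`. -/
def Mp (n : ℕ) (ħ : ℝ) : Subgroup ((L2 n ≃ₗᵢ[ℂ] L2 n) × Sp n) :=
  Subgroup.closure {a | ∃ (W : GeneratingFunction n) (m : ℤ),
    W.IsMaslovIndex m ∧ IsQuadraticFourier ħ W m a.1 ∧ W.Generates a.2}

/-- The unitary representation of the metaplectic group on `L²(ℝⁿ)`. -/
def Mp.op {n : ℕ} {ħ : ℝ} : Mp n ħ →* (L2 n ≃ₗᵢ[ℂ] L2 n) :=
  (MonoidHom.fst _ _).comp (Mp n ħ).subtype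

/-- The projection `π^Mp : Mp(n, ℝ) → Sp(n, ℝ)`. -/
def Mp.proj {n : ℕ} {ħ : ℝ} : Mp n ħ →* Sp n :=
  (MonoidHom.snd _ _).comp (Mp n ħ).subtype

end CohenClass

end

open scoped SchwartzMap

noncomputable section

namespace CohenClass

open MeasureTheory LineDeriv
open scoped ContDiff InnerProductSpace ComplexConjugate

open scoped FourierTransform

/-! ### Chirps -/

/-! Everything rests on the covariance W(Ŝf)(Sw) = Wf(w) of the Wigner transform. Once this is
known, W(Ŝf) = Wf ∘ S⁻¹, and the formula for Q follows from a linear change of variables in the test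
function, with no Jacobian because det S = 1 (`conv_compEquiv`).

Covariance, together with invariance of the Schwartz space, passes to products, so it suffices to
check generators and their inverses. A quadratic Fourier transform is, up to a constant,
multiplication by the chirp of Q, then the Fourier transform, then the dilation x ↦ Lx/2πħ, then
multiplication by the chirp of P. Each factor acts on Wigner functions by a linear map of phase
space: a chirp by a shear in the momentum (`crossWigner_chirp_mul`), a dilation by its lift to phase
space with a Jacobian factor (`crossWigner_comp_linear`), the Fourier transform by exchanging
position and momentum up to sign and the scale 2πħ (`crossWigner_fourier`, an instance of Parseval).
The squared modulus of the constant cancels the Jacobian, and the composed linear map is exactly the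
relation between (x', p') and (x, p) that defines S_W (`crossWigner_schwartzTransform`).

All factors are bijective on the Schwartz space, which gives the invariance for generators and for
their inverses. -/

theorem hasTemperateGrowth_cexp {c : ℂ} (hc : c.re = 0) :
    (fun t : ℝ => Complex.exp (c * (t : ℂ))).HasTemperateGrowth := by
  have hder : ∀ t : ℝ, HasDerivAt (fun t : ℝ => Complex.exp (c * (t : ℂ)))
      (c * Complex.exp (c * (t : ℂ))) t := fun t => by
    simpa [mul_comm] using ((Complex.ofRealCLM.hasDerivAt (x := t)).const_mul c).cexp
  have hiter : ∀ m : ℕ, iteratedDeriv m (fun t : ℝ => Complex.exp (c * (t : ℂ))) =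
      fun t : ℝ => c ^ m * Complex.exp (c * (t : ℂ)) := fun m => by
    induction m with
    | zero => simp
    | succ m ih =>
      funext t
      rw [iteratedDeriv_succ, ih, ((hder t).const_mul _).deriv]
      ring
  -- The m-th derivative has constant modulus ‖c‖ ^ m, so growth exponent 0 suffices.
  refine ⟨(contDiff_const.mul Complex.ofRealCLM.contDiff).cexp, fun m => ⟨0, ‖c‖ ^ m, fun t => ?_⟩⟩
  rw [norm_iteratedFDeriv_eq_norm_iteratedDeriv, hiter, norm_mul, norm_exp_phase hc]
  simp

/-- The chirp `x ↦ exp((i/ħ) ½ Bx·x)`. -/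
def chirp {n : ℕ} (ħ : ℝ) (B : Config n →L[ℝ] Config n) (x : Config n) : ℂ :=
  Complex.exp (Complex.I / ħ * ((1 / 2 * ⟪B x, x⟫_ℝ : ℝ) : ℂ))

theorem hasTemperateGrowth_chirp {n : ℕ} (ħ : ℝ) (B : Config n →L[ℝ] Config n) :
    (chirp ħ B).HasTemperateGrowth := by
  have h : (fun x : Config n => 1 / 2 * ⟪B x, x⟫_ℝ).HasTemperateGrowth :=
    (Function.HasTemperateGrowth.const (1 / 2 : ℝ)).mul
      ((innerSL ℝ).bilinear_hasTemperateGrowth B.hasTemperateGrowth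
        Function.HasTemperateGrowth.id')
  exact (hasTemperateGrowth_cexp (c := Complex.I / ħ) (by simp [Complex.div_re])).comp h

/-- Multiplication of a Schwartz function by a chirp. -/
def chirpMul {n : ℕ} (ħ : ℝ) (B : Config n →L[ℝ] Config n) (f : 𝓢(Config n, ℂ)) :
    𝓢(Config n, ℂ) :=
  SchwartzMap.smulLeftCLM ℂ (chirp ħ B) f

theorem chirpMul_apply {n : ℕ} (ħ : ℝ) (B : Config n →L[ℝ] Config n) (f : 𝓢(Config n, ℂ))
    (x : Config n) : chirpMul ħ B f x = chirp ħ B x * f x := by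
  rw [chirpMul, SchwartzMap.smulLeftCLM_apply_apply (hasTemperateGrowth_chirp ħ B), smul_eq_mul]

theorem chirpMul_chirpMul_neg {n : ℕ} (ħ : ℝ) (B : Config n →L[ℝ] Config n)
    (f : 𝓢(Config n, ℂ)) : chirpMul ħ B (chirpMul ħ (-B) f) = f := by
  ext x
  rw [chirpMul_apply, chirpMul_apply, ← mul_assoc, chirp, chirp, ← Complex.exp_add]
  simp

/-! ### Covariance of the Wigner transform -/

/-- The phase space point with position `x` and momentum `p`. -/
def phasePoint {n : ℕ} (x p : Config n) : Phase n := WithLp.toLp 2 (Sum.elim x p)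

@[simp] theorem pos_phasePoint {n : ℕ} (x p : Config n) : pos (phasePoint x p) = x := rfl

@[simp] theorem mom_phasePoint {n : ℕ} (x p : Config n) : mom (phasePoint x p) = p := rfl

theorem phasePoint_pos_mom {n : ℕ} (z : Phase n) : phasePoint (pos z) (mom z) = z := by
  ext i; rcases i with i | i <;> rfl

/-- For symmetric B the polarisation identity ½B(x + y/2)·(x + y/2) - ½B(x - y/2)·(x - y/2) = Bx·y
makes the two chirps contribute a phase linear in y, which is absorbed into the momentum. -/
theorem crossWigner_chirp_mul {n : ℕ} (ħ : ℝ) {B : Config n →L[ℝ] Config n}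
    (hB : ∀ x y, ⟪B x, y⟫_ℝ = ⟪x, B y⟫_ℝ) (f : Config n → ℂ) (x p : Config n) :
    crossWigner ħ (fun y => chirp ħ B y * f y) (fun y => chirp ħ B y * f y) (phasePoint x p) =
      crossWigner ħ f f (phasePoint x (p - B x)) := by
  simp only [crossWigner, pos_phasePoint, mom_phasePoint]
  congr 2
  funext y
  have hphase : Complex.exp (-(Complex.I / ħ) * (⟪p, y⟫_ℝ : ℂ)) *
      (chirp ħ B (x + (1 / 2 : ℝ) • y) * conj (chirp ħ B (x - (1 / 2 : ℝ) • y))) =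
      Complex.exp (-(Complex.I / ħ) * (⟪p - B x, y⟫_ℝ : ℂ)) := by
    simp only [chirp, ← Complex.exp_conj, ← Complex.exp_add]
    congr 1
    have hyx : ⟪B y, x⟫_ℝ = ⟪B x, y⟫_ℝ := by rw [hB, real_inner_comm]
    simp only [map_mul, map_div₀, Complex.conj_I, Complex.conj_ofReal, map_add, map_sub,
      map_smul, inner_add_left, inner_add_right, inner_sub_left, inner_sub_right,
      inner_smul_left, inner_smul_right, hyx, conj_trivial]
    push_cast
    ring
  rw [← hphase, map_mul]
  ring

theorem crossWigner_const_mul {n : ℕ} (ħ : ℝ) (c : ℂ) (f : Config n → ℂ) (z : Phase n) :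
    crossWigner ħ (fun y => c * f y) (fun y => c * f y) z =
      ((‖c‖ ^ 2 : ℝ) : ℂ) * crossWigner ħ f f z := by
  simp only [crossWigner]
  rw [mul_left_comm, ← integral_const_mul (((‖c‖ ^ 2 : ℝ) : ℂ))]
  congr 2
  funext y
  rw [map_mul, Complex.ofReal_pow, ← Complex.mul_conj']
  ring

theorem integral_comp_continuousLinearEquiv {n : ℕ} (A : Config n ≃L[ℝ] Config n)
    (F : Config n → ℂ) :
    ∫ y, F (A y) = ((|LinearMap.det (A : Config n →ₗ[ℝ] Config n)|⁻¹ : ℝ) : ℂ) * ∫ y, F y := by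
  have hdet : LinearMap.det (A : Config n →ₗ[ℝ] Config n) ≠ 0 :=
    (LinearEquiv.isUnit_det' A.toLinearEquiv).ne_zero
  have hmap := Measure.map_linearMap_addHaar_eq_smul_addHaar
    (volume : Measure (Config n)) hdet
  have h := A.toHomeomorph.measurableEmbedding.integral_map (μ := volume) F
  have h' : Measure.map (⇑A.toHomeomorph) (volume : Measure (Config n)) = _ := hmap
  rw [h', integral_smul_measure, ENNReal.toReal_ofReal (abs_nonneg _), abs_inv] at h
  rw [← Complex.real_smul, h]
  rfl

/-- Substitution of Ay for y in the integral. The hypothesis says p = Aᵀq; stating it weakly avoids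
forming the inverse transpose of A. -/
theorem crossWigner_comp_linear {n : ℕ} (ħ : ℝ) (A : Config n ≃L[ℝ] Config n)
    (f : Config n → ℂ) (x p q : Config n) (hq : ∀ y, ⟪q, A y⟫_ℝ = ⟪p, y⟫_ℝ) :
    crossWigner ħ (fun y => f (A y)) (fun y => f (A y)) (phasePoint x p) =
      ((|LinearMap.det (A : Config n →ₗ[ℝ] Config n)|⁻¹ : ℝ) : ℂ) *
        crossWigner ħ f f (phasePoint (A x) q) := by
  simp only [crossWigner, pos_phasePoint, mom_phasePoint]
  rw [mul_left_comm, ← integral_comp_continuousLinearEquiv]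
  simp only [hq, map_add, map_sub, map_smul]

/-! ### The Fourier transform as a rotation of phase space -/

theorem integral_eq_of_comp_two_smul {n : ℕ} {F G : Config n → ℂ}
    (h : ∫ y, F ((2 : ℝ) • y) = ∫ y, G ((2 : ℝ) • y)) : ∫ y, F y = ∫ y, G y := by
  rw [Measure.integral_comp_smul, Measure.integral_comp_smul] at h
  exact smul_right_injective ℂ (by positivity : |((2 : ℝ) ^ Module.finrank ℝ (Config n))⁻¹| ≠ 0) h

/-- The character `u ↦ exp(-2πi u·x)` of configuration space. -/
def planeWave {n : ℕ} (x u : Config n) : ℂ :=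
  Complex.exp (-(2 * Real.pi * Complex.I) * (⟪u, x⟫_ℝ : ℂ))

theorem hasTemperateGrowth_planeWave {n : ℕ} (x : Config n) :
    (planeWave x).HasTemperateGrowth :=
  (hasTemperateGrowth_cexp (c := -(2 * Real.pi * Complex.I)) (by simp)).comp
    (Function.hasTemperateGrowth_inner_left x)

theorem fourier_eq_integral_planeWave {n : ℕ} (f : 𝓢(Config n, ℂ)) (x : Config n) :
    𝓕 f x = ∫ u, planeWave x u * f u := by
  rw [SchwartzMap.fourier_coe, Real.fourier_eq']
  congr 1
  funext u
  rw [smul_eq_mul, planeWave]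
  congr 2
  push_cast
  ring

/-- Parseval for two modulated and translated copies φ, ψ of f, one of them reflected: 𝓕φ conj(𝓕ψ)
is the integrand on the left, and φ conj(ψ) is, after a translation, the integrand on the right. -/
theorem crossWigner_fourier {n : ℕ} {ħ : ℝ} (hħ : 0 < ħ) (f : 𝓢(Config n, ℂ))
    (x q : Config n) :
    crossWigner ħ (𝓕 f : 𝓢(Config n, ℂ)) (𝓕 f : 𝓢(Config n, ℂ))
        (phasePoint x (-((2 * Real.pi * ħ) • q))) =
      crossWigner ħ f f (phasePoint q ((2 * Real.pi * ħ) • x)) := by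
  have hħ' : (ħ : ℂ) ≠ 0 := by exact_mod_cast hħ.ne'
  simp only [crossWigner, pos_phasePoint, mom_phasePoint]
  congr 1
  -- Doubling y on both sides turns x ± y/2 into x ± y; the Jacobians agree and cancel.
  apply integral_eq_of_comp_two_smul
  -- Modulation by x moves the argument of the transform to x ± y; the translation by 2q produces
  -- the phase exp(4πi q·y).
  let φ : 𝓢(Config n, ℂ) := SchwartzMap.compSubConstCLM ℂ (-((2 : ℝ) • q))
    (SchwartzMap.smulLeftCLM ℂ (planeWave x) f)
  let ψ : 𝓢(Config n, ℂ) := SchwartzMap.smulLeftCLM ℂ (planeWave (-x))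
    (SchwartzMap.compCLMOfContinuousLinearEquiv ℂ (ContinuousLinearEquiv.neg ℝ) f)
  have hφ : ∀ u, φ u = planeWave x (u + (2 : ℝ) • q) * f (u + (2 : ℝ) • q) := fun u => by
    simp [φ, SchwartzMap.smulLeftCLM_apply_apply (hasTemperateGrowth_planeWave x)]
  have hψ : ∀ u, ψ u = planeWave (-x) u * f (-u) := fun u => by
    simp [ψ, SchwartzMap.smulLeftCLM_apply_apply (hasTemperateGrowth_planeWave (-x))]
  have hFφ : ∀ y, 𝓕 φ y = planeWave y (-((2 : ℝ) • q)) * 𝓕 f (x + y) := fun y => by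
    rw [fourier_eq_integral_planeWave, fourier_eq_integral_planeWave, ← integral_const_mul,
      ← integral_add_right_eq_self _ (-((2 : ℝ) • q))]
    congr 1
    funext u
    rw [hφ, neg_add_cancel_right, ← mul_assoc, ← mul_assoc]
    simp only [planeWave, ← Complex.exp_add, inner_add_left, inner_add_right]
    congr 2
    push_cast
    ring
  have hFψ : ∀ y, 𝓕 ψ y = 𝓕 f (x - y) := fun y => by
    rw [fourier_eq_integral_planeWave, fourier_eq_integral_planeWave, ← integral_neg_eq_self]
    congr 1
    funext u
    rw [hψ, neg_neg, ← mul_assoc]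
    simp only [planeWave, ← Complex.exp_add, inner_sub_right, inner_neg_left, inner_neg_right]
    congr 2
    push_cast
    ring
  have key := SchwartzMap.integral_inner_fourier_fourier ψ φ
  simp only [RCLike.inner_apply, hFφ, hFψ, hφ, hψ] at key
  -- Parseval leaves the arguments u + 2q and -u; putting u = y - q makes them q ± y.
  refine Eq.trans ?_ (key.trans ((integral_sub_right_eq_self _ q).symm.trans ?_))
  · congr 1
    funext y
    rw [smul_smul]
    norm_num
    left; left
    rw [planeWave]
    congr 1
    simp only [inner_neg_left, inner_smul_left, inner_smul_right, conj_trivial]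
    push_cast
    field_simp
  · congr 1
    funext y
    have h1 : y - q + (2 : ℝ) • q = q + y := by module
    have h2 : Complex.exp (-(Complex.I / ħ) * (⟪(2 * Real.pi * ħ) • x, (2 : ℝ) • y⟫_ℝ : ℂ)) =
        planeWave x (q + y) * conj (planeWave (-x) (y - q)) := by
      simp only [planeWave, ← Complex.exp_conj, ← Complex.exp_add]
      congr 1
      simp only [map_mul, map_neg, Complex.conj_I, Complex.conj_ofReal, inner_smul_left,
        inner_smul_right, inner_neg_right, inner_add_left, inner_sub_left, conj_trivial,
        real_inner_comm x y, map_ofNat]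
      push_cast
      field_simp
      ring
    rw [h1, h2, smul_smul, map_mul, neg_sub, one_div, inv_mul_cancel₀ two_ne_zero, one_smul]
    ring

/-! ### Quadratic Fourier transforms on the Schwartz space -/

/-- The linear automorphism of configuration space given by an invertible matrix. -/
def configEquiv {n : ℕ} (M : Matrix (Fin n) (Fin n) ℝ) (hM : M.det ≠ 0) :
    Config n ≃L[ℝ] Config n :=
  ContinuousLinearEquiv.equivOfInverse
    (Matrix.toEuclideanCLM (𝕜 := ℝ) M) (Matrix.toEuclideanCLM (𝕜 := ℝ) M⁻¹)
    (fun x => by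
      rw [← mul_apply_eq_comp, ← map_mul, Matrix.nonsing_inv_mul M hM.isUnit]; simp)
    (fun x => by
      rw [← mul_apply_eq_comp, ← map_mul, Matrix.mul_nonsing_inv M hM.isUnit]; simp)

theorem configEquiv_apply {n : ℕ} (M : Matrix (Fin n) (Fin n) ℝ) (hM : M.det ≠ 0)
    (x : Config n) : configEquiv M hM x = Matrix.toEuclideanCLM (𝕜 := ℝ) M x := rfl

theorem det_toEuclideanCLM {ι : Type*} [Fintype ι] [DecidableEq ι] (M : Matrix ι ι ℝ) :
    LinearMap.det (Matrix.toEuclideanCLM (𝕜 := ℝ) M :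
      EuclideanSpace ℝ ι →ₗ[ℝ] EuclideanSpace ℝ ι) = M.det := by
  rw [Matrix.coe_toEuclideanCLM_eq_toEuclideanLin]
  exact LinearMap.det_toLpLin 2 M

open scoped Matrix in
theorem inner_toEuclideanCLM_left {n : ℕ} (M : Matrix (Fin n) (Fin n) ℝ) (x y : Config n) :
    ⟪Matrix.toEuclideanCLM (𝕜 := ℝ) M x, y⟫_ℝ =
      ⟪x, Matrix.toEuclideanCLM (𝕜 := ℝ) Mᵀ y⟫_ℝ := by
  rw [real_inner_comm, Matrix.inner_toEuclideanCLM, Matrix.inner_toEuclideanCLM,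
    Matrix.mulVec_transpose, Matrix.dotProduct_mulVec, dotProduct_comm]

namespace GeneratingFunction

variable {n : ℕ} (W : GeneratingFunction n)

/-- The operator `P` on configuration space. -/
def opP : Config n →L[ℝ] Config n := Matrix.toEuclideanCLM (𝕜 := ℝ) W.P

/-- The operator `L` on configuration space. -/
def opL : Config n →L[ℝ] Config n := Matrix.toEuclideanCLM (𝕜 := ℝ) W.L

/-- The operator `Q` on configuration space. -/
def opQ : Config n →L[ℝ] Config n := Matrix.toEuclideanCLM (𝕜 := ℝ) W.Q

/-- The transpose of `L`, as an operator on configuration space. -/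
def opLt : Config n →L[ℝ] Config n := Matrix.toEuclideanCLM (𝕜 := ℝ) W.L.transpose

theorem inner_opP (x y : Config n) : ⟪W.opP x, y⟫_ℝ = ⟪x, W.opP y⟫_ℝ := by
  rw [opP, inner_toEuclideanCLM_left, W.P_symm]

theorem inner_opQ (x y : Config n) : ⟪W.opQ x, y⟫_ℝ = ⟪x, W.opQ y⟫_ℝ := by
  rw [opQ, inner_toEuclideanCLM_left, W.Q_symm]

theorem inner_opLt (x y : Config n) : ⟪W.opLt x, y⟫_ℝ = ⟪x, W.opL y⟫_ℝ := by
  rw [opLt, inner_toEuclideanCLM_left, Matrix.transpose_transpose, opL]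

theorem val_eq_inner (x y : Config n) :
    W.val x y = 1 / 2 * ⟪W.opP x, x⟫_ℝ - ⟪W.opL x, y⟫_ℝ + 1 / 2 * ⟪W.opQ y, y⟫_ℝ := by
  simp only [val, opP, opL, opQ, EuclideanSpace.inner_eq_star_dotProduct, star_trivial,
    Matrix.ofLp_toEuclideanCLM, dotProduct_comm]

theorem det_smul_L_ne_zero {r : ℝ} (hr : r ≠ 0) : (r • W.L).det ≠ 0 := by
  rw [Matrix.det_smul]
  exact mul_ne_zero (pow_ne_zero _ hr) W.L_det

/-- The map `x ↦ Lx / 2πħ`. -/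
def scaledL {ħ : ℝ} (hħ : 0 < ħ) : Config n ≃L[ℝ] Config n :=
  configEquiv ((2 * Real.pi * ħ)⁻¹ • W.L) (W.det_smul_L_ne_zero (by positivity))

theorem scaledL_apply {ħ : ℝ} (hħ : 0 < ħ) (x : Config n) :
    W.scaledL hħ x = (2 * Real.pi * ħ)⁻¹ • W.opL x := by
  rw [scaledL, configEquiv_apply, map_smul, opL]
  rfl

theorem det_scaledL {ħ : ℝ} (hħ : 0 < ħ) :
    LinearMap.det (W.scaledL hħ : Config n →ₗ[ℝ] Config n) =
      (2 * Real.pi * ħ)⁻¹ ^ n * W.L.det := by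
  have h := det_toEuclideanCLM ((2 * Real.pi * ħ)⁻¹ • W.L)
  rw [Matrix.det_smul, Fintype.card_fin] at h
  exact h

/-- The constant in front of the quadratic Fourier transform. -/
def fourierConst (ħ : ℝ) (m : ℤ) : ℂ :=
  (1 / (2 * Real.pi * Complex.I * ħ) : ℂ) ^ ((n : ℂ) / 2) * Complex.I ^ m
    * (Real.sqrt |W.L.det| : ℂ)

/-- The choice of branch and the Maslov index do not matter: the square of the power is the n-th
power whatever the branch, and i^m has modulus one. What remains is (2πħ)⁻ⁿ|det L|, the Jacobian of
the dilation. -/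
theorem norm_sq_fourierConst {ħ : ℝ} (hħ : 0 < ħ) (m : ℤ) :
    ‖W.fourierConst ħ m‖ ^ 2 = |LinearMap.det (W.scaledL hħ : Config n →ₗ[ℝ] Config n)| := by
  have h1 : ‖(1 / (2 * Real.pi * Complex.I * ħ) : ℂ) ^ ((n : ℂ) / 2)‖ ^ 2 =
      (2 * Real.pi * ħ)⁻¹ ^ n := by
    rw [← norm_pow, ← Complex.cpow_nat_mul]
    have : ((2 : ℕ) : ℂ) * ((n : ℂ) / 2) = n := by push_cast; ring
    rw [this, Complex.cpow_natCast, norm_pow]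
    congr 1
    simp [abs_of_pos hħ, abs_of_pos Real.pi_pos]
  rw [fourierConst, norm_mul, norm_mul, mul_pow, mul_pow, h1, norm_zpow, Complex.norm_I,
    one_zpow, one_pow, mul_one, Complex.norm_real, Real.norm_eq_abs, sq_abs,
    Real.sq_sqrt (abs_nonneg _), det_scaledL, abs_mul,
    abs_of_pos (a := (2 * Real.pi * ħ)⁻¹ ^ n) (by positivity)]

theorem fourierConst_ne_zero {ħ : ℝ} (hħ : 0 < ħ) (m : ℤ) : W.fourierConst ħ m ≠ 0 := by
  have h := W.norm_sq_fourierConst hħ m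
  intro h0
  rw [h0, norm_zero, zero_pow two_ne_zero, eq_comm, abs_eq_zero] at h
  exact (LinearEquiv.isUnit_det' (W.scaledL hħ).toLinearEquiv).ne_zero h

/-- The quadratic Fourier transform of a Schwartz function, as a Schwartz function. -/
def schwartzTransform {ħ : ℝ} (hħ : 0 < ħ) (m : ℤ) (f : 𝓢(Config n, ℂ)) : 𝓢(Config n, ℂ) :=
  W.fourierConst ħ m • chirpMul ħ W.opP
    (SchwartzMap.compCLMOfContinuousLinearEquiv ℂ (W.scaledL hħ) (𝓕 (chirpMul ħ W.opQ f)))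

theorem schwartzTransform_apply {ħ : ℝ} (hħ : 0 < ħ) (m : ℤ) (f : 𝓢(Config n, ℂ))
    (x : Config n) : W.schwartzTransform hħ m f x = W.fourierConst ħ m *
      (chirp ħ W.opP x * 𝓕 (chirpMul ħ W.opQ f) (W.scaledL hħ x)) := by
  rw [schwartzTransform, smul_apply, chirpMul_apply, smul_eq_mul]
  rfl

/-- The three terms of the generating function separate: the P and Q terms are the chirps, and the
mixed term -(i/ħ) Lx·y is the Fourier kernel at frequency Lx/2πħ. -/
theorem coe_schwartzTransform {ħ : ℝ} (hħ : 0 < ħ) (m : ℤ) (f : 𝓢(Config n, ℂ)) :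
    ⇑(W.schwartzTransform hħ m f) = quadraticFourier ħ W m f := by
  have hħ' : (ħ : ℂ) ≠ 0 := by exact_mod_cast hħ.ne'
  funext x
  rw [schwartzTransform_apply, quadraticFourier, fourierConst, fourier_eq_integral_planeWave,
    ← integral_const_mul (chirp ħ W.opP x)]
  congr 2
  funext y
  rw [chirpMul_apply, ← mul_assoc, ← mul_assoc, chirp, chirp, planeWave, ← Complex.exp_add,
    ← Complex.exp_add, val_eq_inner, scaledL_apply, inner_smul_right, real_inner_comm (W.opL x) y]
  congr 2
  push_cast
  field_simp
  ring

theorem schwartzTransform_surjective {ħ : ℝ} (hħ : 0 < ħ) (m : ℤ) :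
    Function.Surjective (W.schwartzTransform hħ m) := fun h => by
  have hneg : ∀ B : Config n →L[ℝ] Config n, ∀ g, chirpMul ħ B (chirpMul ħ (-B) g) = g :=
    chirpMul_chirpMul_neg ħ
  refine ⟨chirpMul ħ (-W.opQ) (𝓕⁻ (SchwartzMap.compCLMOfContinuousLinearEquiv ℂ
    (W.scaledL hħ).symm (chirpMul ħ (-W.opP) ((W.fourierConst ħ m)⁻¹ • h)))), ?_⟩
  have hcomp : ∀ g : 𝓢(Config n, ℂ), SchwartzMap.compCLMOfContinuousLinearEquiv ℂ
      (W.scaledL hħ) (SchwartzMap.compCLMOfContinuousLinearEquiv ℂ (W.scaledL hħ).symm g) = g :=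
    fun g => by ext x; simp
  rw [schwartzTransform, hneg, FourierTransform.fourier_fourierInv_eq, hcomp, hneg,
    smul_inv_smul₀ (W.fourierConst_ne_zero hħ m)]

theorem crossWigner_schwartzTransform {ħ : ℝ} (hħ : 0 < ħ) (m : ℤ) (f : 𝓢(Config n, ℂ))
    (x y : Config n) :
    crossWigner ħ (W.schwartzTransform hħ m f) (W.schwartzTransform hħ m f)
        (phasePoint x (W.opP x - W.opLt y)) =
      crossWigner ħ f f (phasePoint y (W.opL x - W.opQ y)) := by
  have hr : 2 * Real.pi * ħ ≠ 0 := by positivity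
  have hdet : |LinearMap.det (W.scaledL hħ : Config n →ₗ[ℝ] Config n)| ≠ 0 :=
    abs_ne_zero.2 (LinearEquiv.isUnit_det' (W.scaledL hħ).toLinearEquiv).ne_zero
  have h1 := funext (W.schwartzTransform_apply hħ m f)
  have h2 := funext (chirpMul_apply ħ W.opQ f)
  rw [h1, crossWigner_const_mul, crossWigner_chirp_mul ħ W.inner_opP
    (fun x => 𝓕 (chirpMul ħ W.opQ f) (W.scaledL hħ x)),
    -- After the P-shear the momentum is -Lᵀy; pulling it back through the transpose of L/2πħ gives
    -- -2πħ y, the form that `crossWigner_fourier` expects.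
    crossWigner_comp_linear ħ (W.scaledL hħ) _ _ _ (-((2 * Real.pi * ħ) • y)),
    crossWigner_fourier hħ, h2, crossWigner_chirp_mul ħ W.inner_opQ, norm_sq_fourierConst W hħ,
    ← mul_assoc, ← Complex.ofReal_mul, mul_inv_cancel₀ hdet, Complex.ofReal_one, one_mul,
    scaledL_apply, smul_inv_smul₀ hr]
  intro u
  rw [scaledL_apply, sub_sub_cancel_left, inner_neg_left, inner_neg_left, inner_smul_left,
    inner_smul_right, inner_opLt, conj_trivial, mul_inv_cancel_left₀ hr]

theorem opLt_surjective : Function.Surjective W.opLt := by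
  have h : W.L.transpose.det ≠ 0 := by rw [Matrix.det_transpose]; exact W.L_det
  exact (configEquiv W.L.transpose h).surjective

theorem crossWigner_schwartzTransform_toEquiv {ħ : ℝ} (hħ : 0 < ħ) (m : ℤ) {S : Sp n}
    (hS : W.Generates S) (f : 𝓢(Config n, ℂ)) (w : Phase n) :
    crossWigner ħ (W.schwartzTransform hħ m f) (W.schwartzTransform hħ m f) (Sp.toEquiv S w) =
      crossWigner ħ f f w := by
  -- As Lᵀ is invertible, every phase space point can be written (x, Px - Lᵀy), so the generating
  -- relation covers all of them.
  obtain ⟨x, y, hxy⟩ : ∃ x y, phasePoint x (W.opP x - W.opLt y) = Sp.toEquiv S w := by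
    obtain ⟨y, hy⟩ := W.opLt_surjective
      (W.opP (pos (Sp.toEquiv S w)) - mom (Sp.toEquiv S w))
    exact ⟨pos (Sp.toEquiv S w), y, by rw [hy, sub_sub_cancel, phasePoint_pos_mom]⟩
  have hSw : Sp.toEquiv S (phasePoint y (W.opL x - W.opQ y)) =
      phasePoint x (W.opP x - W.opLt y) :=
    congrArg (WithLp.toLp 2) (hS x.ofLp y.ofLp)
  rw [← hxy, crossWigner_schwartzTransform, (Sp.toEquiv S).injective (hSw.trans hxy)]

end GeneratingFunction

/-! ### Covariance under the metaplectic group -/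

/-- The pair of an operator `U` and a symplectic matrix `S` maps Schwartz functions to Schwartz
functions and transforms their Wigner functions by `S`. -/
def IsWignerCovariant {n : ℕ} (ħ : ℝ) (a : (L2 n ≃ₗᵢ[ℂ] L2 n) × Sp n) : Prop :=
  ∀ f : 𝓢(Config n, ℂ), ∃ g : 𝓢(Config n, ℂ), g.toLp 2 = a.1 (f.toLp 2) ∧
    ∀ w : Phase n, crossWigner ħ g g (Sp.toEquiv a.2 w) = crossWigner ħ f f w

theorem Sp.toEquiv_apply {n : ℕ} (S : Sp n) (w : Phase n) : Sp.toEquiv S w =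
    Matrix.toEuclideanCLM (𝕜 := ℝ) (S : Matrix (Fin n ⊕ Fin n) (Fin n ⊕ Fin n) ℝ) w := rfl

theorem Sp.toEquiv_one {n : ℕ} (w : Phase n) : Sp.toEquiv (1 : Sp n) w = w := by
  rw [Sp.toEquiv_apply, Submonoid.coe_one, map_one, one_apply_eq_self]

theorem Sp.toEquiv_mul {n : ℕ} (S T : Sp n) (w : Phase n) :
    Sp.toEquiv (S * T) w = Sp.toEquiv S (Sp.toEquiv T w) := by
  rw [Sp.toEquiv_apply, Sp.toEquiv_apply, Sp.toEquiv_apply, Submonoid.coe_mul, map_mul,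
    mul_apply_eq_comp]

theorem IsWignerCovariant.one {n : ℕ} (ħ : ℝ) : IsWignerCovariant (n := n) ħ 1 :=
  fun f => ⟨f, rfl, fun w => by rw [Prod.snd_one, Sp.toEquiv_one]⟩

theorem IsWignerCovariant.mul {n : ℕ} {ħ : ℝ} {a b : (L2 n ≃ₗᵢ[ℂ] L2 n) × Sp n}
    (ha : IsWignerCovariant ħ a) (hb : IsWignerCovariant ħ b) : IsWignerCovariant ħ (a * b) :=
  fun f => by
    obtain ⟨g, hg, hgW⟩ := hb f
    obtain ⟨h, hh, hhW⟩ := ha g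
    refine ⟨h, by rw [hh, hg]; rfl, fun w => ?_⟩
    rw [Prod.snd_mul, Sp.toEquiv_mul, hhW, hgW]

theorem IsQuadraticFourier.toLp_schwartzTransform {n : ℕ} {ħ : ℝ} (hħ : 0 < ħ)
    {W : GeneratingFunction n} {m : ℤ} {U : L2 n ≃ₗᵢ[ℂ] L2 n} (hU : IsQuadraticFourier ħ W m U)
    (f : 𝓢(Config n, ℂ)) : (W.schwartzTransform hħ m f).toLp 2 = U (f.toLp 2) := by
  refine Lp.ext (((W.schwartzTransform hħ m f).coeFn_toLp 2).trans ?_)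
  rw [W.coe_schwartzTransform]
  exact (hU f).symm

/-- The inverse is treated separately because covariance alone does not make an operator map onto
the Schwartz space; here surjectivity of the explicit transform supplies Schwartz preimages. -/
theorem IsWignerCovariant.of_generates {n : ℕ} {ħ : ℝ} (hħ : 0 < ħ)
    {W : GeneratingFunction n} {m : ℤ} {a : (L2 n ≃ₗᵢ[ℂ] L2 n) × Sp n}
    (hU : IsQuadraticFourier ħ W m a.1) (hS : W.Generates a.2) :
    IsWignerCovariant ħ a ∧ IsWignerCovariant ħ a⁻¹ := by
  refine ⟨fun f => ⟨_, hU.toLp_schwartzTransform hħ f,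
    W.crossWigner_schwartzTransform_toEquiv hħ m hS f⟩, fun h => ?_⟩
  obtain ⟨f, rfl⟩ := W.schwartzTransform_surjective hħ m h
  refine ⟨f, ?_, fun w => ?_⟩
  · rw [hU.toLp_schwartzTransform hħ]
    exact (a.1.symm_apply_apply _).symm
  · rw [← W.crossWigner_schwartzTransform_toEquiv hħ m hS, ← Sp.toEquiv_mul, Prod.snd_inv,
      mul_inv_cancel, Sp.toEquiv_one]

theorem Mp.isWignerCovariant {n : ℕ} {ħ : ℝ} (hħ : 0 < ħ) (a : Mp n ħ) :
    IsWignerCovariant ħ (a : (L2 n ≃ₗᵢ[ℂ] L2 n) × Sp n) := by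
  -- The induction carries b and b⁻¹ together, so that the inverse case is a mere exchange.
  suffices h : ∀ b ∈ Mp n ħ, IsWignerCovariant ħ b ∧ IsWignerCovariant ħ b⁻¹ from
    (h a a.2).1
  intro b hb
  induction hb using Subgroup.closure_induction with
  | mem b hb =>
    obtain ⟨W, m, -, hU, hS⟩ := hb
    exact IsWignerCovariant.of_generates hħ hU hS
  | one => exact ⟨.one ħ, by rw [inv_one]; exact .one ħ⟩
  | mul b c _ _ hb hc => exact ⟨hb.1.mul hc.1, by rw [mul_inv_rev]; exact hc.2.mul hb.2⟩
  | inv b _ hb => exact ⟨hb.2, by rw [inv_inv]; exact hb.1⟩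

/-! ### Transfer to convolutions with tempered distributions -/

theorem Sp.det_toEquiv {n : ℕ} (S : Sp n) :
    LinearMap.det (Sp.toEquiv S : Phase n →ₗ[ℝ] Phase n) = 1 :=
  (det_toEuclideanCLM (S : Matrix (Fin n ⊕ Fin n) (Fin n ⊕ Fin n) ℝ)).trans
    (SymplecticGroup.det_eq_one S.2)

/-- Both sides pair θ with the test function w ↦ Φ(S⁻¹(z - w)), by linearity of S⁻¹. -/
theorem conv_compEquiv {n : ℕ} (Φ : 𝓢(Phase n, ℂ)) (θ : 𝓢'(Phase n, ℂ)) (S : Sp n)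
    (z : Phase n) :
    conv Φ (compEquiv θ (Sp.toEquiv S)) ((Sp.toEquiv S).symm z) =
      conv (SchwartzMap.compCLMOfContinuousLinearEquiv ℂ (Sp.toEquiv S).symm Φ) θ z := by
  have h : compEquiv θ (Sp.toEquiv S) = PointwiseConvergenceCLM.precomp ℂ
      (SchwartzMap.compCLMOfContinuousLinearEquiv ℂ (Sp.toEquiv S).symm) θ := by
    rw [compEquiv, Sp.det_toEquiv, abs_one, inv_one, Complex.ofReal_one, one_smul]
  rw [h, conv, conv]
  change θ _ = θ _
  congr 1
  ext w
  simp

theorem IsWignerCovariant.exists_wigner_eq {n : ℕ} {ħ : ℝ} (hħ : 0 < ħ)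
    {a : (L2 n ≃ₗᵢ[ℂ] L2 n) × Sp n} (ha : IsWignerCovariant ħ a) (f : 𝓢(Config n, ℂ)) :
    ∃ g : 𝓢(Config n, ℂ), g.toLp 2 = a.1 (f.toLp 2) ∧ wigner hħ g =
      SchwartzMap.compCLMOfContinuousLinearEquiv ℂ (Sp.toEquiv a.2).symm (wigner hħ f) := by
  obtain ⟨g, hg, hW⟩ := ha f
  refine ⟨g, hg, ?_⟩
  ext w
  rw [SchwartzMap.compCLMOfContinuousLinearEquiv_apply, Function.comp_apply, wigner_apply,
    wigner_apply, ← hW, ContinuousLinearEquiv.apply_symm_apply]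

end CohenClass

end

theorem proposition4p1 (n : ℕ) {ħ : ℝ} (hħ : 0 < ħ)
    (θ : 𝓢'(CohenClass.Phase n, ℂ))
    (Q : 𝓢(CohenClass.Config n, ℂ) → CohenClass.Phase n → ℂ)
    (hQ : CohenClass.IsCohenWithKernel hħ θ Q)
    (Shat : CohenClass.Mp n ħ) (f : 𝓢(CohenClass.Config n, ℂ)) :
    ∃ g : 𝓢(CohenClass.Config n, ℂ),
      g.toLp 2 = CohenClass.Mp.op Shat (f.toLp 2) ∧
      ∀ z : CohenClass.Phase n,
        Q g z =
          CohenClass.conv (CohenClass.wigner hħ f)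
            (CohenClass.compEquiv θ (CohenClass.Sp.toEquiv (CohenClass.Mp.proj Shat)))
            ((CohenClass.Sp.toEquiv (CohenClass.Mp.proj Shat)).symm z) := by
  obtain ⟨g, hg, hW⟩ := (CohenClass.Mp.isWignerCovariant hħ Shat).exists_wigner_eq hħ f
  refine ⟨g, hg, fun z => ?_⟩
  have hconv := CohenClass.conv_compEquiv (CohenClass.wigner hħ f) θ (CohenClass.Mp.proj Shat) z
  have hg' := congrFun (hQ g) z
  exact hg'.trans ((congrArg (fun Φ => CohenClass.conv Φ θ z) hW).trans hconv.symm)
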